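/- Let $n\ge 1$, let $\mathbb B^n$ be the open Euclidean unit ball of $\mathbb C^n$, and let $\varphi:\mathbb B^n\to\mathbb B^n$ be analytic with $\varphi(0)=0$ and $\varphi'(0)$ invertible. Assume that $\varphi$ is not unitary on any slice, i.e. there are no unit vectors $\zeta,\eta\in\mathbb C^n$ with $\varphi(t\zeta)=t\eta$ for all $t\in\mathbb C$ with $|t|<1$. Let $\lambda_1,\dots,\lambda_m$ be the eigenvalues of $\varphi'(0)$. An eigenvalue $\mu$ of $\varphi'(0)$ is called resonant if $\mu=\lambda_1^{k_1}\cdots\lambda_m^{k_m}$ for some non-negative integers $k_i$ with $\sum_i k_i>1$. (1) Let $D$ be an invertible matrix such that $D\varphi'(0)D^{-1}$ is an upper triangular Jordan matrix, let $\mu$ be an eigenvalue of $\varphi'(0)$, and let $L_\mu^t$ be the block diagonal matrix formed by those Jordan blocks of $D\varphi'(0)D^{-1}$ that have eigenvalue $\mu$; let $d$ be its size. If $\mu$ is not resonant, then there is an analytic $F_\mu:\mathbb B^n\to\mathbb C^{d}$ with $F_\mu\circ\varphi=L_\mu^t F_\mu$ on $\mathbb B^n$ that has full rank near $0$, i.e.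 $F_\mu'(z)$ has rank $d$ for all $z$ in a neighbourhood of $0$. (2) If $\varphi'(0)$ has no resonant eigenvalue, then there is an analytic $F:\mathbb B^n\to\mathbb C^n$ with $F\circ\varphi=\varphi'(0)F$ on $\mathbb B^n$ that has full rank near $0$, i.e. $F'(z)$ is invertible for all $z$ in a neighbourhood of $0$. -/

import Mathlib

/-- The complex Jacobian matrix of `F` at `z`: its entry in row `i`, column `j` is the partial
derivative `∂F_i/∂z_j` at `z`. -/
noncomputable def jacobian {n : ℕ} {ι : Type} [Fintype ι]
    (F : EuclideanSpace ℂ (Fin n) → EuclideanSpace ℂ ι) (z : EuclideanSpace ℂ (Fin n)) :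
    Matrix ι (Fin n) ℂ :=
  Matrix.of fun i j => fderiv ℂ F z (EuclideanSpace.single j 1) i

/-- `φ` is unitary on the slice of the unit ball through some unit vector `ζ`: it maps this complex
disc isometrically and linearly onto the slice through some unit vector `η`. -/
def IsUnitaryOnSomeSlice {n : ℕ}
    (φ : EuclideanSpace ℂ (Fin n) → EuclideanSpace ℂ (Fin n)) : Prop :=
  ∃ ζ η : EuclideanSpace ℂ (Fin n), ‖ζ‖ = 1 ∧ ‖η‖ = 1 ∧
    ∀ t : ℂ, ‖t‖ < 1 → φ (t • ζ) = t • η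

/-- `μ` is a resonant eigenvalue of `A`: an eigenvalue that is a product of powers of eigenvalues of
`A` with non-negative integer exponents whose sum exceeds one. -/
def IsResonantEigenvalue {n : ℕ} (A : Matrix (Fin n) (Fin n) ℂ) (μ : ℂ) : Prop :=
  μ ∈ spectrum ℂ A ∧
    ∃ e : spectrum ℂ A →₀ ℕ, 1 < (e.sum fun _ p => p) ∧ μ = e.prod fun c p => (c : ℂ) ^ p

/-- The upper triangular Jordan block of size `k` with eigenvalue `c`. -/
noncomputable def jordanBlock (c : ℂ) (k : ℕ) : Matrix (Fin k) (Fin k) ℂ :=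
  Matrix.of fun i j => if i = j then c else if (i : ℕ) + 1 = (j : ℕ) then 1 else 0

/-- The block diagonal matrix whose diagonal blocks are the upper triangular Jordan blocks of sizes
`k b` with eigenvalues `c b`. -/
noncomputable def jordanMatrix {β : Type} [DecidableEq β] (c : β → ℂ) (k : β → ℕ) :
    Matrix (Σ b, Fin (k b)) (Σ b, Fin (k b)) ℂ :=
  Matrix.blockDiagonal' fun b => jordanBlock (c b) (k b)

/-- The Jordan matrix with `m` (nonempty) blocks of sizes `k j` and eigenvalues `c j` is a Jordan
form of `A`, that is, `D * A * D⁻¹` equals it for some invertible `D` (here `E = D⁻¹`). -/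
def IsJordanForm {n m : ℕ} (A : Matrix (Fin n) (Fin n) ℂ) (c : Fin m → ℂ) (k : Fin m → ℕ) : Prop :=
  (∀ j, 0 < k j) ∧
    ∃ (D : Matrix (Σ j, Fin (k j)) (Fin n) ℂ) (E : Matrix (Fin n) (Σ j, Fin (k j)) ℂ),
      D * E = 1 ∧ E * D = 1 ∧ D * A * E = jordanMatrix c k

/-- The part of a Jordan matrix made of the blocks with eigenvalue `μ`, in the same order. -/
noncomputable def jordanPart {m : ℕ} (c : Fin m → ℂ) (k : Fin m → ℕ) (μ : ℂ) :
    Matrix (Σ j : {j : Fin m // c j = μ}, Fin (k j)) (Σ j : {j : Fin m // c j = μ}, Fin (k j)) ℂ :=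
  jordanMatrix (fun j : {j : Fin m // c j = μ} => c j) (fun j => k j)

/-- `F` is an analytic map on the unit ball that solves `F ∘ φ = M F` there and has full rank (that
is, linearly independent differentials of its components) at every point near the origin. -/
structure IsFullRankSolution {n : ℕ} {ι : Type} [Fintype ι]
    (φ : EuclideanSpace ℂ (Fin n) → EuclideanSpace ℂ (Fin n)) (M : Matrix ι ι ℂ)
    (F : EuclideanSpace ℂ (Fin n) → EuclideanSpace ℂ ι) : Prop where
  analytic : AnalyticOnNhd ℂ F (Metric.ball 0 1)
  equation : ∀ z ∈ Metric.ball (0 : EuclideanSpace ℂ (Fin n)) 1,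
    F (φ z) = WithLp.toLp 2 (M.mulVec (F z))
  full_rank : ∀ᶠ z in nhds (0 : EuclideanSpace ℂ (Fin n)), (jacobian F z).rank = Fintype.card ι

/-! Write `A` for `φ'(0)`, and let `M` be the target matrix and `D` a linear map with `D A = M D`
and a right inverse. The aim is an analytic `F` with `F ∘ φ = M F` and `F'(0) = D`; full rank near
the origin then follows by continuity of a determinant. Both parts are instances: `D` is the
identity, or consists of the rows of the Jordan basis change that belong to the blocks of `μ`.

`F` is the Koenigs-type limit of `M⁻ᵐ F₀ ∘ φᵐ`. Successive limands differ by `M⁻ᵐ⁻¹ (F₀ ∘ φ - M F₀)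
∘ φᵐ`. By the Schwarz lemma, whose equality case is excluded by the slice hypothesis, `φ` contracts
each smaller ball by a factor `q < 1`. So the limit exists near the origin once `F₀ ∘ φ - M F₀ =
O(‖z‖ᵏ)` with `‖M⁻¹‖ qᵏ < 1` (`exists_local_limit`).

Such an `F₀` is built from `D` degree by degree (`exists_approximate_solution`). Removing the error
of degree `K ≥ 2` means solving `Q ∘ A - M Q = -R` for a `K`-linear `Q`, which is possible because
no product of `K` eigenvalues of `A` is an eigenvalue of `M`. Every orbit tends to the origin, which
carries the local limit to the whole ball (`exists_linearization`). -/

/-! ### Cauchy estimates and normally convergent series of analytic maps -/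

section AnalyticSeries

open Metric Set

variable {E F : Type*} [NormedAddCommGroup E] [NormedSpace ℂ E]
  [NormedAddCommGroup F] [NormedSpace ℂ F] [CompleteSpace F]

/-- Each differentiation gives up a collar of width `s` and costs a factor `2 / s`, by the
Schwarz-type bound on the derivative at the centre of a ball. -/
theorem AnalyticOnNhd.norm_iteratedFDeriv_le_of_norm_le {f : E → F} {R M s : ℝ}
    (hf : AnalyticOnNhd ℂ f (ball 0 R)) (hM : ∀ z ∈ ball (0 : E) R, ‖f z‖ ≤ M) (hs : 0 < s)
    (k : ℕ) : ∀ z : E, ‖z‖ + k * s < R → ‖iteratedFDeriv ℂ k f z‖ ≤ M * (2 / s) ^ k := by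
  induction k with
  | zero =>
    intro z hz
    simpa using hM z (by simpa using hz)
  | succ k ih =>
    intro z hz
    push_cast at hz
    rw [← norm_fderiv_iteratedFDeriv]
    have hmem : ∀ w ∈ ball z s, ‖w‖ + k * s < R := by
      intro w hw
      have h1 : ‖w‖ ≤ ‖z‖ + ‖w - z‖ := norm_le_norm_add_norm_sub z w |>.trans (by
        rw [norm_sub_rev])
      have h2 : ‖w - z‖ < s := by simpa [dist_eq_norm] using hw
      linarith
    have hk : 0 ≤ (k : ℝ) * s := by positivity
    have hd : DifferentiableOn ℂ (iteratedFDeriv ℂ k f) (ball z s) := fun w hw =>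
      ((hf.iteratedFDeriv k) w (by
        have := hmem w hw
        simp; linarith)).differentiableAt.differentiableWithinAt
    have hmaps : MapsTo (iteratedFDeriv ℂ k f) (ball z s)
        (closedBall (iteratedFDeriv ℂ k f z) (2 * (M * (2 / s) ^ k))) := by
      intro w hw
      rw [mem_closedBall, dist_eq_norm, two_mul]
      exact (norm_sub_le _ _).trans
        (add_le_add (ih w (hmem w hw)) (ih z (hmem z (mem_ball_self hs))))
    refine (Complex.norm_fderiv_le_div_of_mapsTo_ball hd hmaps hs).trans_eq ?_
    ring

theorem AnalyticOnNhd.norm_iteratedFDeriv_zero_le {f : E → F} {R M : ℝ} (hR : 0 < R)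
    (hf : AnalyticOnNhd ℂ f (ball 0 R)) (hM : ∀ z ∈ ball (0 : E) R, ‖f z‖ ≤ M) (k : ℕ) :
    ‖((k.factorial : ℂ)⁻¹) • iteratedFDeriv ℂ k f 0‖ ≤
      M * (Real.exp 1 * (2 * Real.exp 1 / R) ^ k) := by
  have hM0 : 0 ≤ M := (norm_nonneg _).trans (hM 0 (mem_ball_self hR))
  -- With `k + 1` in place of `k` the `k` collars fit strictly inside the ball, and `k = 0` needs no
  -- separate case.
  have hs : 0 < R / (k + 1) := by positivity
  have h := hf.norm_iteratedFDeriv_le_of_norm_le hM hs k 0 (by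
    rw [norm_zero, zero_add, mul_div_assoc', div_lt_iff₀ (by positivity)]
    nlinarith)
  rw [norm_smul, norm_inv, Complex.norm_natCast]
  have hfac : (0 : ℝ) < k.factorial := by exact_mod_cast k.factorial_pos
  have hexp : ((k : ℝ) + 1) ^ k / k.factorial ≤ Real.exp 1 * Real.exp 1 ^ k := by
    refine (Real.pow_div_factorial_le_exp (x := (k : ℝ) + 1) (by positivity) k).trans_eq ?_
    rw [add_comm, Real.exp_add, ← Real.exp_nat_mul, mul_one]
  calc (k.factorial : ℝ)⁻¹ * ‖iteratedFDeriv ℂ k f 0‖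
      ≤ (k.factorial : ℝ)⁻¹ * (M * (2 / (R / (k + 1))) ^ k) := by gcongr
    _ = M * (2 / R) ^ k * (((k : ℝ) + 1) ^ k / k.factorial) := by
        rw [div_div_eq_mul_div, mul_div_right_comm, mul_pow]; ring
    _ ≤ M * (2 / R) ^ k * (Real.exp 1 * Real.exp 1 ^ k) := by gcongr
    _ = _ := by rw [mul_div_right_comm, mul_pow]; ring

/-- The coefficient bounds give a radius of convergence depending only on `R`; the identity theorem
identifies the sum with `f`. This uniform radius is what allows infinitely many expansions to be
added. -/
theorem AnalyticOnNhd.hasSum_iteratedFDeriv_zero {f : E → F} {R M : ℝ} (hR : 0 < R)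
    (hf : AnalyticOnNhd ℂ f (ball 0 R)) (hM : ∀ z ∈ ball (0 : E) R, ‖f z‖ ≤ M) {z : E}
    (hz : ‖z‖ < R / (2 * Real.exp 1)) :
    HasSum (fun k => ((k.factorial : ℂ)⁻¹ • iteratedFDeriv ℂ k f 0) fun _ => z) (f z) := by
  set p : FormalMultilinearSeries ℂ E F :=
    fun k => (k.factorial : ℂ)⁻¹ • iteratedFDeriv ℂ k f 0 with hp
  have he : 0 < 2 * Real.exp 1 := by positivity
  set r : NNReal := ⟨R / (2 * Real.exp 1), by positivity⟩ with hr
  have hr0 : (0 : ENNReal) < r := by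
    rw [ENNReal.coe_pos, ← NNReal.coe_pos]; exact div_pos hR he
  have hrad : (r : ENNReal) ≤ p.radius := by
    refine p.le_radius_of_bound (M * Real.exp 1) fun k => ?_
    have := hf.norm_iteratedFDeriv_zero_le hR hM k
    calc ‖p k‖ * (r : ℝ) ^ k
        ≤ (M * (Real.exp 1 * (2 * Real.exp 1 / R) ^ k)) * (R / (2 * Real.exp 1)) ^ k := by
          exact mul_le_mul_of_nonneg_right this (pow_nonneg (div_pos hR he).le k)
      _ = M * Real.exp 1 * ((2 * Real.exp 1 / R) * (R / (2 * Real.exp 1))) ^ k := by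
          rw [mul_pow]; ring
      _ = M * Real.exp 1 := by
          rw [div_mul_div_cancel₀ hR.ne', div_self he.ne', one_pow, mul_one]
  have hps : HasFPowerSeriesOnBall p.sum p 0 r :=
    (p.hasFPowerSeriesOnBall (hr0.trans_le hrad)).mono hr0 hrad
  have hball : Metric.eball (0 : E) r = ball 0 (R / (2 * Real.exp 1)) := by
    rw [Metric.eball_coe]; rfl
  have hsub : ball (0 : E) (R / (2 * Real.exp 1)) ⊆ ball 0 R := by
    refine ball_subset_ball (div_le_self hR.le ?_)
    have := Real.add_one_le_exp (1 : ℝ)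
    linarith
  obtain ⟨q, ρ, hq⟩ := hf 0 (mem_ball_self hR)
  have hev : f =ᶠ[nhds 0] p.sum := by
    have h1 := hq.eventually_hasSum
    filter_upwards [h1] with y hy
    have hterm : (fun k => q k fun _ => y) = fun k => p k fun _ => y := by
      funext k
      have := hq.factorial_smul y k
      rw [hp]
      have hk : (k.factorial : ℂ) ≠ 0 := by exact_mod_cast k.factorial_ne_zero
      simp only [smul_apply]
      rw [eq_inv_smul_iff₀ hk, ← this, Nat.cast_smul_eq_nsmul]
    rw [zero_add, hterm] at hy
    exact hy.tsum_eq.symm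
  have heq : EqOn f p.sum (ball 0 (R / (2 * Real.exp 1))) := by
    refine AnalyticOnNhd.eqOn_of_preconnected_of_eventuallyEq (hf.mono hsub) ?_
      (convex_ball _ _).isPreconnected (mem_ball_self (div_pos hR he)) hev
    rw [← hball]
    exact hps.analyticOnNhd
  have hzb : z ∈ ball (0 : E) (R / (2 * Real.exp 1)) := by simpa using hz
  rw [heq hzb]
  have := hps.hasSum (y := z) (by rw [hball]; exact hzb)
  rwa [zero_add] at this

/-- A normally convergent series of analytic functions on a ball is analytic at its centre. -/
theorem analyticAt_tsum {f : ℕ → E → F} {u : ℕ → ℝ} {R : ℝ} (hR : 0 < R)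
    (hf : ∀ i, AnalyticOnNhd ℂ (f i) (ball 0 R)) (hu : Summable u)
    (hM : ∀ i, ∀ z ∈ ball (0 : E) R, ‖f i z‖ ≤ u i) :
    AnalyticAt ℂ (fun z => ∑' i, f i z) 0 := by
  set c : ∀ _ k : ℕ, ContinuousMultilinearMap ℂ (fun _ : Fin k => E) F :=
    fun i k => (k.factorial : ℂ)⁻¹ • iteratedFDeriv ℂ k (f i) 0
  set B : ℕ → ℝ := fun k => Real.exp 1 * (2 * Real.exp 1 / R) ^ k with hB
  have hB0 : ∀ k, 0 ≤ B k := fun k => by positivity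
  have hu0 : ∀ i, 0 ≤ u i := fun i => (norm_nonneg _).trans (hM i 0 (mem_ball_self hR))
  have hcB : ∀ i k, ‖c i k‖ ≤ u i * B k := fun i k =>
    (hf i).norm_iteratedFDeriv_zero_le hR (hM i) k
  have hfs : ∀ i, ∀ z : E, ‖z‖ < R / (2 * Real.exp 1) →
      HasSum (fun k => c i k fun _ => z) (f i z) := fun i z hz =>
    (hf i).hasSum_iteratedFDeriv_zero hR (hM i) hz
  clear_value c
  have hcs : ∀ k, Summable fun i => c i k := fun k =>
    Summable.of_norm_bounded (hu.mul_right (B k)) fun i => hcB i k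
  set P : FormalMultilinearSeries ℂ E F := fun k => ∑' i, c i k with hP
  have hPB : ∀ k, ‖P k‖ ≤ (∑' i, u i) * B k := fun k =>
    tsum_of_norm_bounded (hu.hasSum.mul_right (B k)) fun i => hcB i k
  have he : 0 < 2 * Real.exp 1 := by positivity
  have hr' : 0 < R / (2 * Real.exp 1) := div_pos hR he
  set r : NNReal := ⟨R / (2 * Real.exp 1), hr'.le⟩ with hr
  have hr0 : (0 : ENNReal) < r := by
    rw [ENNReal.coe_pos, ← NNReal.coe_pos]; exact hr'
  have hrad : (r : ENNReal) ≤ P.radius := by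
    refine P.le_radius_of_bound ((∑' i, u i) * Real.exp 1) fun k => ?_
    calc ‖P k‖ * (r : ℝ) ^ k
        ≤ ((∑' i, u i) * B k) * (R / (2 * Real.exp 1)) ^ k :=
          mul_le_mul_of_nonneg_right (hPB k) (pow_nonneg hr'.le k)
      _ = (∑' i, u i) * Real.exp 1 * ((2 * Real.exp 1 / R) * (R / (2 * Real.exp 1))) ^ k := by
          rw [mul_pow, hB]; ring
      _ = (∑' i, u i) * Real.exp 1 := by
          rw [div_mul_div_cancel₀ hR.ne', div_self he.ne', one_pow, mul_one]
  refine HasFPowerSeriesAt.analyticAt (p := P) ⟨r, hrad, hr0, fun {z} hz => ?_⟩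
  have hzr : ‖z‖ < R / (2 * Real.exp 1) := by
    rw [Metric.eball_coe] at hz
    exact mem_ball_zero_iff.mp hz
  rw [zero_add]
  have hgeo : Summable fun k => B k * ‖z‖ ^ k := by
    have h1 : ∀ k, B k * ‖z‖ ^ k = Real.exp 1 * (2 * Real.exp 1 / R * ‖z‖) ^ k := fun k => by
      rw [hB, mul_pow]; ring
    simp_rw [h1]
    refine (summable_geometric_of_lt_one (by positivity) ?_).mul_left _
    rw [lt_div_iff₀ he] at hzr
    rw [div_mul_eq_mul_div, div_lt_one hR]
    linarith
  have hterm : ∀ i k, ‖c i k fun _ => z‖ ≤ u i * (B k * ‖z‖ ^ k) := fun i k => by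
    refine ((c i k).le_opNorm _).trans ?_
    rw [Finset.prod_const, Finset.card_univ, Fintype.card_fin, ← mul_assoc]
    exact mul_le_mul_of_nonneg_right (hcB i k) (by positivity)
  -- Absolute convergence over pairs lets the double series be summed by functions or by degrees.
  have hsum : Summable fun x : ℕ × ℕ => c x.1 x.2 fun _ => z :=
    Summable.of_norm_bounded
      (hu.mul_of_nonneg hgeo hu0 fun k => mul_nonneg (hB0 k) (by positivity))
      fun x => hterm x.1 x.2
  have h1 : HasSum (fun i => f i z) (∑' x : ℕ × ℕ, c x.1 x.2 fun _ => z) :=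
    hsum.hasSum.prod_fiberwise fun i => hfs i z hzr
  have h2 : HasSum (fun k => P k fun _ => z) (∑' x : ℕ × ℕ, c x.1 x.2 fun _ => z) := by
    have hswap : HasSum (fun x : ℕ × ℕ => c x.2 x.1 fun _ => z)
        (∑' x : ℕ × ℕ, c x.1 x.2 fun _ => z) :=
      (Equiv.prodComm ℕ ℕ).hasSum_iff.mpr hsum.hasSum
    refine hswap.prod_fiberwise fun k => ?_
    exact (ContinuousMultilinearMap.apply ℂ (fun _ : Fin k => E) F fun _ => z).hasSum
      (hcs k).hasSum
  rwa [h1.tsum_eq]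

end AnalyticSeries

/-! ### Schwarz lemma and strict contraction -/

section Contraction

open Metric Set

variable {n : ℕ} {φ : EuclideanSpace ℂ (Fin n) → EuclideanSpace ℂ (Fin n)}

theorem norm_lt_of_not_isUnitaryOnSomeSlice (hφ : AnalyticOnNhd ℂ φ (ball 0 1))
    (hmaps : MapsTo φ (ball 0 1) (ball 0 1)) (hzero : φ 0 = 0)
    (hslice : ¬ IsUnitaryOnSomeSlice φ) {z : EuclideanSpace ℂ (Fin n)} (hz : z ≠ 0)
    (hz1 : ‖z‖ < 1) : ‖φ z‖ < ‖z‖ := by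
  have hz0 : 0 < ‖z‖ := norm_pos_iff.mpr hz
  have hle : ‖φ z‖ ≤ ‖z‖ :=
    Complex.norm_le_norm_of_mapsTo_ball hφ.differentiableOn
      (fun w hw => ball_subset_closedBall (hmaps hw)) hzero hz1
  refine lt_of_le_of_ne hle fun heq => hslice ?_
  set ζ : EuclideanSpace ℂ (Fin n) := ((‖z‖ : ℂ)⁻¹) • z with hζ
  have hzc : (‖z‖ : ℂ) ≠ 0 := by exact_mod_cast hz0.ne'
  have hζ1 : ‖ζ‖ = 1 := by
    rw [hζ, norm_smul, norm_inv, Complex.norm_real, norm_norm, inv_mul_cancel₀ hz0.ne']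
  have hzζ : (‖z‖ : ℂ) • ζ = z := by rw [hζ, smul_inv_smul₀ hzc]
  have hsl : MapsTo (fun t : ℂ => t • ζ) (ball 0 1) (ball 0 1) := fun t ht => by
    simpa [norm_smul, hζ1] using ht
  have hd : DifferentiableOn ℂ (fun t : ℂ => φ (t • ζ)) (ball 0 1) :=
    hφ.differentiableOn.comp (by fun_prop) hsl
  -- Equality at `z` gives the slice map a slope of norm one at `t = ‖z‖`, the extremal case of the
  -- Schwarz lemma.
  obtain ⟨C, hC, hEq⟩ := Complex.affine_of_mapsTo_ball_of_exists_norm_dslope_eq_div'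
    (R₂ := 1) hd (by
      intro t ht
      simpa [hzero] using (mem_ball_zero_iff.mp (hmaps (hsl ht))).le)
    ⟨(‖z‖ : ℂ), by simpa using hz1, by
      rw [dslope_of_ne _ hzc, slope_def_module]
      simp only [zero_smul, hzero, sub_zero, hzζ]
      rw [norm_smul, norm_inv, Complex.norm_real, norm_norm, heq, inv_mul_cancel₀ hz0.ne', div_one]⟩
  refine ⟨ζ, C, hζ1, by simpa using hC, fun t ht => ?_⟩
  have := hEq (mem_ball_zero_iff.mpr ht)
  simpa [hzero] using this

/-- By compactness the maximum of `‖φ‖` on the closed ball of radius `r` is below `r`; the Schwarz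
lemma on that ball gives the ratio as contraction factor. -/
theorem exists_norm_le_mul_of_not_isUnitaryOnSomeSlice (hφ : AnalyticOnNhd ℂ φ (ball 0 1))
    (hmaps : MapsTo φ (ball 0 1) (ball 0 1)) (hzero : φ 0 = 0)
    (hslice : ¬ IsUnitaryOnSomeSlice φ) {r : ℝ} (hr0 : 0 < r) (hr1 : r < 1) :
    ∃ q : ℝ, 0 ≤ q ∧ q < 1 ∧ ∀ z, ‖z‖ < r → ‖φ z‖ ≤ q * ‖z‖ := by
  have hsub : closedBall (0 : EuclideanSpace ℂ (Fin n)) r ⊆ ball 0 1 :=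
    closedBall_subset_ball hr1
  obtain ⟨w, hw, hmax⟩ := (isCompact_closedBall (0 : EuclideanSpace ℂ (Fin n)) r).exists_isMaxOn
    ⟨0, mem_closedBall_self hr0.le⟩ (hφ.continuousOn.mono hsub).norm
  have hlt : ‖φ w‖ < r := by
    rcases eq_or_ne w 0 with rfl | hw0
    · simpa [hzero] using hr0
    · exact (norm_lt_of_not_isUnitaryOnSomeSlice hφ hmaps hzero hslice hw0
        (mem_ball_zero_iff.mp (hsub hw))).trans_le (mem_closedBall_zero_iff.mp hw)
  refine ⟨‖φ w‖ / r, by positivity, (div_lt_one hr0).mpr hlt, fun z hz => ?_⟩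
  have := Complex.dist_le_div_mul_dist_of_mapsTo_ball (f := φ) (c := 0) (R₁ := r) (R₂ := ‖φ w‖)
    (hφ.differentiableOn.mono (ball_subset_closedBall.trans hsub))
    (fun v hv => by
      simpa [hzero] using hmax (ball_subset_closedBall hv)) (mem_ball_zero_iff.mpr hz)
  simpa [hzero] using this

end Contraction

/-! ### Injectivity of the homological operator -/

section Homological

open Module

variable {E W : Type*} [AddCommGroup E] [Module ℂ E]
  [AddCommGroup W] [Module ℂ W]

/-- Write `A (v i)` as `c i • v i` plus a generalized eigenvector of lower order and expand. By
induction on the total order all mixed terms vanish, so a nonzero `Q v` would be an eigenvector of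
`J` for `∏ i, c i`. -/
theorem MultilinearMap.apply_genEigenvectors_eq_zero {K : ℕ}
    {A : End ℂ E} {J : End ℂ W} (Q : MultilinearMap ℂ (fun _ : Fin K => E) W)
    (hQ : ∀ v, Q (fun i => A (v i)) = J (Q v)) {c : Fin K → ℂ}
    (hJ : ¬ J.HasEigenvalue (∏ i, c i)) (N : ℕ) :
    ∀ r : Fin K → ℕ, ∑ i, r i = N → ∀ v : Fin K → E,
      (∀ i, ((A - algebraMap ℂ (End ℂ E) (c i)) ^ r i) (v i) = 0) → Q v = 0 := by
  induction N using Nat.strong_induction_on with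
  | _ N ih =>
  intro r hr v hv
  by_cases h0 : ∃ i, r i = 0
  · obtain ⟨i, hi⟩ := h0
    exact Q.map_coord_zero i (by simpa [hi] using hv i)
  push Not at h0
  set w : Fin K → E := fun i => (A - algebraMap ℂ (End ℂ E) (c i)) (v i) with hw
  have hAv : (fun i => A (v i)) = (fun i => c i • v i) + w := by
    funext i
    simp [hw, Module.algebraMap_end_apply]
  have hexp : Q (fun i => A (v i)) = (∏ i, c i) • Q v := by
    rw [hAv, Q.map_add_univ, Finset.sum_eq_single Finset.univ]
    · simp [Q.map_smul_univ]
    · intro s _ hs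
      set r' : Fin K → ℕ := s.piecewise r fun i => r i - 1 with hr'
      obtain ⟨j, hj⟩ : ∃ j, j ∉ s := by
        by_contra! h
        exact hs (Finset.eq_univ_iff_forall.mpr h)
      have hlt : ∑ i, r' i < N := by
        rw [← hr]
        refine Finset.sum_lt_sum (fun i _ => ?_) ⟨j, Finset.mem_univ j, ?_⟩
        · by_cases hi : i ∈ s <;> simp [hr', hi]
        · have := h0 j
          simp [hr', hj]; omega
      refine ih _ hlt r' rfl _ fun i => ?_
      by_cases hi : i ∈ s
      · simp [hr', hi, hv i]
      · simp only [hr', hi, Finset.piecewise_eq_of_notMem, not_false_eq_true, hw]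
        rw [← Module.End.mul_apply, ← pow_succ, Nat.sub_add_cancel (Nat.pos_of_ne_zero (h0 i))]
        exact hv i
    · simp
  by_contra hne
  exact hJ (Module.End.hasEigenvalue_of_hasEigenvector
    ⟨Module.End.mem_eigenspace_iff.mpr (by rw [← hQ, hexp]), hne⟩)

theorem Module.End.exists_basis_mem_maxGenEigenspace [FiniteDimensional ℂ E] (A : End ℂ E) :
    ∃ (s : Set E) (b : Basis s ℂ E) (c : s → ℂ),
      ∀ i, A.HasEigenvalue (c i) ∧ b i ∈ A.maxGenEigenspace (c i) := by
  have hspan : ⊤ ≤ Submodule.span ℂ (⋃ c : ℂ, (A.maxGenEigenspace c : Set E)) := by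
    rw [← A.iSup_maxGenEigenspace_eq_top, Submodule.iSup_eq_span]
  set b := Basis.ofSpan hspan
  have hb : ∀ i, ∃ c : ℂ, A.HasEigenvalue c ∧ b i ∈ A.maxGenEigenspace c := fun i => by
    obtain ⟨c, hc⟩ := Set.mem_iUnion.mp (Basis.ofSpan_subset hspan ⟨i, rfl⟩)
    refine ⟨c, ?_, hc⟩
    have hne : A.HasUnifEigenvalue c ⊤ := fun hbot => by
      have hi : b i ∈ A.genEigenspace c ⊤ := hc
      rw [hbot] at hi
      exact b.ne_zero i hi
    exact hne.lt one_pos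
  choose c hc using hb
  exact ⟨_, b, c, hc⟩

theorem MultilinearMap.eq_zero_of_comp_eq [FiniteDimensional ℂ E] {K : ℕ} {A : End ℂ E} {J : End ℂ W}
    (hJ : ∀ c : Fin K → ℂ, (∀ i, A.HasEigenvalue (c i)) → ¬ J.HasEigenvalue (∏ i, c i))
    (Q : MultilinearMap ℂ (fun _ : Fin K => E) W)
    (hQ : ∀ v, Q (fun i => A (v i)) = J (Q v)) : Q = 0 := by
  obtain ⟨s, b, c, hb⟩ := A.exists_basis_mem_maxGenEigenspace
  refine Basis.ext_multilinear (fun _ => b) fun v => ?_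
  have h : ∀ i, ∃ r : ℕ, ((A - algebraMap ℂ (End ℂ E) (c (v i))) ^ r) (b (v i)) = 0 := fun i => by
    simpa [Module.End.mem_maxGenEigenspace, Algebra.algebraMap_eq_smul_one] using (hb (v i)).2
  choose r hr using h
  exact Q.apply_genEigenvectors_eq_zero hQ (c := fun i => c (v i))
    (hJ _ fun i => (hb (v i)).1) _ r rfl _ hr

end Homological

/-! ### Solving the equation to finite order -/

section FormalSolution

open Module Asymptotics Topology

variable {E W : Type*} [NormedAddCommGroup E] [NormedSpace ℂ E] [FiniteDimensional ℂ E]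
  [NormedAddCommGroup W] [NormedSpace ℂ W] [FiniteDimensional ℂ W]

instance ContinuousMultilinearMap.finiteDimensional {K : ℕ} :
    FiniteDimensional ℂ (ContinuousMultilinearMap ℂ (fun _ : Fin K => E) W) :=
  FiniteDimensional.of_injective
    (ContinuousMultilinearMap.toMultilinearMapLinear :
      ContinuousMultilinearMap ℂ (fun _ : Fin K => E) W →ₗ[ℂ] _)
    ContinuousMultilinearMap.toMultilinearMap_injective

/-- The space of `K`-linear maps is finite-dimensional, so injectivity of the homological operator
implies surjectivity. -/
theorem ContinuousMultilinearMap.exists_comp_sub_eq {K : ℕ} {A : E →L[ℂ] E} {J : W →L[ℂ] W}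
    (hJ : ∀ c : Fin K → ℂ, (∀ i, End.HasEigenvalue (A : End ℂ E) (c i)) →
      ¬ End.HasEigenvalue (J : End ℂ W) (∏ i, c i))
    (R : ContinuousMultilinearMap ℂ (fun _ : Fin K => E) W) :
    ∃ Q : ContinuousMultilinearMap ℂ (fun _ : Fin K => E) W,
      ∀ v, Q (fun i => A (v i)) - J (Q v) = R v := by
  let S : ContinuousMultilinearMap ℂ (fun _ : Fin K => E) W →ₗ[ℂ]
      ContinuousMultilinearMap ℂ (fun _ : Fin K => E) W :=
    { toFun := fun Q => Q.compContinuousLinearMap (fun _ => A) -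
        J.compContinuousMultilinearMap Q
      map_add' := fun P Q => by ext v; simp; abel
      map_smul' := fun a Q => by ext v; simp [smul_sub] }
  have hS : ∀ Q v, S Q v = Q (fun i => A (v i)) - J (Q v) := fun Q v => rfl
  have hinj : Function.Injective S := by
    rw [injective_iff_map_eq_zero]
    intro Q hQ
    refine ContinuousMultilinearMap.toMultilinearMap_injective ?_
    refine MultilinearMap.eq_zero_of_comp_eq hJ Q.toMultilinearMap fun v => ?_
    have := hS Q v
    rw [hQ] at this
    exact (sub_eq_zero.mp this.symm)
  obtain ⟨Q, hQ⟩ := LinearMap.injective_iff_surjective.mp hinj R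
  exact ⟨Q, fun v => by rw [← hS, hQ]⟩

omit [FiniteDimensional ℂ E] [FiniteDimensional ℂ W] in
-- The growth bound kills, on the diagonal, all Taylor terms of degree below `K`; `R` is the term of
-- degree `K`.
theorem AnalyticAt.exists_isBigO_sub_multilinear {G : E → W} (hG : AnalyticAt ℂ G 0) {K : ℕ}
    (hGK : G =O[𝓝 0] fun z => ‖z‖ ^ K) :
    ∃ R : ContinuousMultilinearMap ℂ (fun _ : Fin K => E) W,
      (fun z => G z - R fun _ => z) =O[𝓝 0] fun z => ‖z‖ ^ (K + 1) := by
  obtain ⟨p, hp⟩ := hG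
  have hz : ∀ m, (∀ z, p.partialSum m z = 0) ∨ K < m := by
    intro m
    induction m with
    | zero => exact Or.inl fun z => by simp [FormalMultilinearSeries.partialSum]
    | succ m ih =>
      rcases ih with ih | ih
      · rcases lt_or_ge m K with hm | hm
        · refine Or.inl fun z => ?_
          have hs : ∀ z, p.partialSum (m + 1) z = p m fun _ => z := fun z => by
            have := ih z
            rw [FormalMultilinearSeries.partialSum] at this ⊢
            rw [Finset.sum_range_succ, this, zero_add]
          have h1 := hp.isBigO_sub_partialSum_pow (m + 1)
          simp only [zero_add, hs] at h1
          have h2 : G =O[𝓝 0] fun z => ‖z‖ ^ (m + 1) := hGK.trans (by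
            refine IsBigO.of_bound 1 ?_
            filter_upwards [Metric.ball_mem_nhds (0 : E) one_pos] with z hz
            rw [one_mul, norm_pow, norm_pow, norm_norm]
            exact pow_le_pow_of_le_one (norm_nonneg _) (mem_ball_zero_iff.mp hz).le hm)
          have h3 := h2.sub h1
          simp only [sub_sub_cancel] at h3
          rw [hs]
          exact h3.continuousMultilinearMap_apply_eq_zero z
        · exact Or.inr (Nat.lt_succ_of_le hm)
      · exact Or.inr (ih.trans (Nat.lt_succ_self m))
  refine ⟨p K, ?_⟩
  have h := hp.isBigO_sub_partialSum_pow (K + 1)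
  have hK := (hz K).resolve_right (lt_irrefl K)
  refine h.congr_left fun z => ?_
  have := hK z
  rw [FormalMultilinearSeries.partialSum] at this ⊢
  rw [Finset.sum_range_succ, this, zero_add, zero_add]

omit [FiniteDimensional ℂ E] [FiniteDimensional ℂ W] in
theorem ContinuousMultilinearMap.isBigO_comp_sub_comp_fderiv {φ : E → E} {A : E →L[ℂ] E}
    (hA : (fun z => φ z - A z) =O[𝓝 0] fun z => ‖z‖ ^ 2) {K : ℕ} (hK : K ≠ 0)
    (Q : ContinuousMultilinearMap ℂ (fun _ : Fin K => E) W) :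
    (fun z => (Q fun _ => φ z) - Q fun _ => A z) =O[𝓝 0] fun z => ‖z‖ ^ (K + 1) := by
  obtain ⟨C, hC0, hC⟩ := hA.exists_pos
  refine IsBigO.of_bound (‖Q‖ * K * (C + ‖A‖) ^ (K - 1) * C) ?_
  filter_upwards [hC.bound, Metric.ball_mem_nhds (0 : E) one_pos] with z hz hz1
  rw [norm_pow, norm_norm] at hz ⊢
  have hz1' := (mem_ball_zero_iff.mp hz1).le
  have : Nonempty (Fin K) := Fin.pos_iff_nonempty.mp (Nat.pos_of_ne_zero hK)
  refine (Q.norm_image_sub_le _ _).trans ?_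
  have hφ : ‖φ z‖ ≤ (C + ‖A‖) * ‖z‖ := by
    have h1 : ‖φ z‖ ≤ ‖φ z - A z‖ + ‖A z‖ := by
      simpa using norm_add_le (φ z - A z) (A z)
    have h2 := A.le_opNorm z
    have h3 : C * ‖z‖ ^ 2 ≤ C * ‖z‖ := by
      gcongr
      nlinarith [norm_nonneg z]
    linarith
  have hAz : ‖A z‖ ≤ (C + ‖A‖) * ‖z‖ := (A.le_opNorm z).trans (by
    gcongr
    linarith)
  have hsub : ‖(fun _ : Fin K => φ z) - fun _ => A z‖ ≤ C * ‖z‖ ^ 2 := by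
    rw [show (fun _ : Fin K => φ z) - (fun _ => A z) = fun _ => φ z - A z from rfl,
      pi_norm_const]
    exact hz
  rw [pi_norm_const, pi_norm_const, Fintype.card_fin]
  calc ‖Q‖ * K * max ‖φ z‖ ‖A z‖ ^ (K - 1) * ‖(fun _ : Fin K => φ z) - fun _ => A z‖
      ≤ ‖Q‖ * K * ((C + ‖A‖) * ‖z‖) ^ (K - 1) * (C * ‖z‖ ^ 2) := by
        gcongr
        exact max_le hφ hAz
    _ = ‖Q‖ * K * (C + ‖A‖) ^ (K - 1) * C * (‖z‖ ^ (K - 1) * ‖z‖ ^ 2) := by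
        rw [mul_pow]; ring
    _ = _ := by rw [← pow_add, show K - 1 + 2 = K + 1 by omega]

omit [FiniteDimensional ℂ E] [FiniteDimensional ℂ W] in
theorem AnalyticAt.isBigO_sub_fderiv {φ : E → W} (hφ : AnalyticAt ℂ φ 0) (h0 : φ 0 = 0) :
    (fun z => φ z - fderiv ℂ φ 0 z) =O[𝓝 0] fun z => ‖z‖ ^ 2 := by
  obtain ⟨p, hp⟩ := hφ
  refine (hp.isBigO_sub_partialSum_pow 2).congr_left fun z => ?_
  rw [hp.fderiv_eq, FormalMultilinearSeries.partialSum]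
  have h1 : (p 0 fun _ => z) = 0 := by rw [← h0]; exact hp.coeff_zero _
  simp only [Finset.sum_range_succ, Finset.sum_range_zero, h1, zero_add]
  rfl

theorem exists_approximate_solution {φ : E → E} (hφ : AnalyticAt ℂ φ 0) (h0 : φ 0 = 0)
    {J : W →L[ℂ] W} {D : E →L[ℂ] W} (hD : ∀ z, D (fderiv ℂ φ 0 z) = J (D z))
    (hJ : ∀ (K : ℕ), 2 ≤ K → ∀ c : Fin K → ℂ,
      (∀ i, End.HasEigenvalue (fderiv ℂ φ 0 : End ℂ E) (c i)) →
      ¬ End.HasEigenvalue (J : End ℂ W) (∏ i, c i)) (K : ℕ) :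
    ∃ F : E → W, AnalyticOnNhd ℂ F Set.univ ∧
      ((fun z => F z - D z) =O[𝓝 0] fun z => ‖z‖ ^ 2) ∧
      (fun z => F (φ z) - J (F z)) =O[𝓝 0] fun z => ‖z‖ ^ (K + 2) := by
  have hA := hφ.isBigO_sub_fderiv h0
  induction K with
  | zero =>
    refine ⟨D, fun z _ => D.analyticAt z, by simpa using isBigO_zero _ _, ?_⟩
    simp only [← hD, ← map_sub]
    exact (D.isBigO_comp _ _).trans hA
  | succ K ih =>
    obtain ⟨F, hF, hFD, hFK⟩ := ih
    have hG : AnalyticAt ℂ (fun z => F (φ z) - J (F z)) 0 :=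
      ((hF _ trivial).comp hφ).sub ((J.analyticAt _).comp (hF 0 trivial))
    obtain ⟨R, hR⟩ := hG.exists_isBigO_sub_multilinear hFK
    obtain ⟨Q, hQ⟩ := ContinuousMultilinearMap.exists_comp_sub_eq
      (hJ (K + 2) (by omega)) (-R)
    refine ⟨fun z => F z + Q fun _ => z, fun z _ => (hF z trivial).add ?_, ?_, ?_⟩
    · exact Q.analyticAt.comp (f := fun z : E => fun _ : Fin (K + 2) => z)
        (AnalyticAt.pi fun _ => analyticAt_id)
    · have hQ2 : (fun z : E => Q fun _ => z) =O[𝓝 0] fun z => ‖z‖ ^ 2 := by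
        refine IsBigO.of_bound ‖Q‖ ?_
        filter_upwards [Metric.ball_mem_nhds (0 : E) one_pos] with z hz
        refine (Q.le_opNorm _).trans ?_
        rw [Finset.prod_const, Finset.card_univ, Fintype.card_fin, norm_pow, norm_norm]
        gcongr ?_ * ?_
        exact pow_le_pow_of_le_one (norm_nonneg _) (mem_ball_zero_iff.mp hz).le (by omega)
      refine (hFD.add hQ2).congr_left fun z => (add_sub_right_comm _ _ _).symm
    -- Replacing `Q ∘ φ` by `Q ∘ φ'(0)` costs one order more, and what remains of the correction
    -- cancels `R`.
    · refine (hR.add (Q.isBigO_comp_sub_comp_fderiv hA (by omega))).congr_left fun z => ?_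
      have h1 : (Q fun _ => fderiv ℂ φ 0 z) = J (Q fun _ => z) - R fun _ => z := by
        have := hQ fun _ => z
        rw [neg_apply] at this
        rw [sub_eq_add_neg, ← this]
        abel
      beta_reduce
      rw [h1, map_add]
      module

end FormalSolution

/-! ### Convergence and extension to the ball -/

section Linearization

open Module Asymptotics Topology Filter Metric Set

variable {E W : Type*} [NormedAddCommGroup E] [NormedSpace ℂ E] [FiniteDimensional ℂ E]
  [NormedAddCommGroup W] [NormedSpace ℂ W] [FiniteDimensional ℂ W]

omit [FiniteDimensional ℂ E] [NormedSpace ℂ E] in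
theorem norm_iterate_le_of_norm_le_mul {φ : E → E} {q r : ℝ} (hq0 : 0 ≤ q) (hq1 : q < 1)
    (hφ : ∀ z, ‖z‖ < r → ‖φ z‖ ≤ q * ‖z‖) {z : E} (hz : ‖z‖ < r) (m : ℕ) :
    ‖φ^[m] z‖ ≤ q ^ m * ‖z‖ := by
  induction m with
  | zero => simp
  | succ m ih =>
    have h1 : q ^ m * ‖z‖ ≤ ‖z‖ :=
      mul_le_of_le_one_left (norm_nonneg z) (pow_le_one₀ hq0 hq1.le)
    rw [Function.iterate_succ_apply', pow_succ']
    refine (hφ _ (ih.trans_lt (h1.trans_lt hz))).trans ?_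
    rw [mul_assoc]
    gcongr

omit [FiniteDimensional ℂ E] in
theorem AnalyticOnNhd.iterate {φ : E → E} {s : Set E} (hφ : AnalyticOnNhd ℂ φ s)
    (hmaps : MapsTo φ s s) (m : ℕ) : AnalyticOnNhd ℂ φ^[m] s := by
  induction m with
  | zero => exact analyticOnNhd_id
  | succ m ih => exact ih.comp hφ hmaps

omit [FiniteDimensional ℂ E] in
theorem exists_local_limit {φ : E → E} {F₀ : E → W} {J J' : W →L[ℂ] W}
    (hJ : ∀ w, J' (J w) = w) {q δ C : ℝ} {k : ℕ} (hδ : 0 < δ) (hC : 0 ≤ C) (hq0 : 0 ≤ q)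
    (hq1 : q < 1)
    (hφ : AnalyticOnNhd ℂ φ (ball 0 δ)) (hφq : ∀ z, ‖z‖ < δ → ‖φ z‖ ≤ q * ‖z‖)
    (hF₀ : AnalyticOnNhd ℂ F₀ (ball 0 δ))
    (hG : ∀ z, ‖z‖ < δ → ‖F₀ (φ z) - J (F₀ z)‖ ≤ C * ‖z‖ ^ k)
    (hk : ‖J'‖ * q ^ k < 1) :
    ∃ F : E → W, AnalyticAt ℂ F 0 ∧ ((fun z => F z - F₀ z) =O[𝓝 0] fun z => ‖z‖ ^ k) ∧
      ∀ z, ‖z‖ < δ → Tendsto (fun m => (J' ^ m) (F₀ (φ^[m] z))) atTop (𝓝 (F z)) := by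
  set G : E → W := fun z => F₀ (φ z) - J (F₀ z) with hGdef
  have hmaps : MapsTo φ (ball 0 δ) (ball 0 δ) := fun z hz => by
    rw [mem_ball_zero_iff] at hz ⊢
    exact (hφq z hz).trans_lt ((mul_le_of_le_one_left (norm_nonneg z) hq1.le).trans_lt hz)
  have hGa : AnalyticOnNhd ℂ G (ball 0 δ) := fun z hz =>
    ((hF₀ _ (hmaps hz)).comp (hφ z hz)).sub ((J.analyticAt _).comp (hF₀ z hz))
  set f : ℕ → E → W := fun m z => (J' ^ (m + 1)) (G (φ^[m] z)) with hf
  have hfa : ∀ m, AnalyticOnNhd ℂ (f m) (ball 0 δ) := fun m =>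
    ((J' ^ (m + 1)).analyticOnNhd univ).comp (hGa.comp (hφ.iterate hmaps m) (hmaps.iterate m))
      (mapsTo_univ _ _)
  set θ := ‖J'‖ * q ^ k with hθ
  have hθ0 : 0 ≤ θ := by positivity
  -- The factor `‖z‖ ^ k` is kept so that the limit agrees with `F₀` to order `k`.
  have hfb : ∀ m, ∀ z, ‖z‖ < δ → ‖f m z‖ ≤ ‖J'‖ * C * ‖z‖ ^ k * θ ^ m := fun m z hz => by
    have h1 : ‖φ^[m] z‖ ≤ q ^ m * ‖z‖ := norm_iterate_le_of_norm_le_mul hq0 hq1 hφq hz m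
    have h2 : ‖φ^[m] z‖ < δ := mem_ball_zero_iff.mp
      (hmaps.iterate m (mem_ball_zero_iff.mpr hz))
    calc ‖f m z‖ ≤ ‖J' ^ (m + 1)‖ * ‖G (φ^[m] z)‖ := ContinuousLinearMap.le_opNorm _ _
      _ ≤ ‖J'‖ ^ (m + 1) * (C * (q ^ m * ‖z‖) ^ k) := by
        gcongr
        · exact norm_pow_le' _ (Nat.succ_pos m)
        · exact (hG _ h2).trans (by gcongr)
      _ = _ := by rw [hθ, mul_pow, mul_pow]; ring
  have hgeo : Summable fun m => θ ^ m := summable_geometric_of_lt_one hθ0 hk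
  have hsum : ∀ z, ‖z‖ < δ → Summable fun m => f m z := fun z hz =>
    Summable.of_norm_bounded (hgeo.mul_left _) fun m => hfb m z hz
  have hS : AnalyticAt ℂ (fun z => ∑' m, f m z) 0 := by
    refine analyticAt_tsum hδ hfa (hgeo.mul_left (‖J'‖ * C * δ ^ k)) fun m z hz => ?_
    rw [mem_ball_zero_iff] at hz
    exact (hfb m z hz).trans (by gcongr)
  refine ⟨fun z => F₀ z + ∑' m, f m z, (hF₀ 0 (mem_ball_self hδ)).add hS, ?_, fun z hz => ?_⟩
  · refine IsBigO.of_bound (‖J'‖ * C * ∑' m, θ ^ m) ?_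
    filter_upwards [ball_mem_nhds (0 : E) hδ] with z hz
    rw [mem_ball_zero_iff] at hz
    rw [add_sub_cancel_left, norm_pow, norm_norm]
    refine (tsum_of_norm_bounded (hgeo.hasSum.mul_left _) fun m => hfb m z hz).trans_eq ?_
    ring
  · have htel : ∀ m, F₀ z + ∑ i ∈ Finset.range m, f i z = (J' ^ m) (F₀ (φ^[m] z)) := fun m => by
      induction m with
      | zero => simp
      | succ m ih =>
        rw [Finset.sum_range_succ, ← add_assoc, ih, hf, hGdef]
        have hmul : ∀ w, (J' ^ m * J') (J w) = (J' ^ m) w := fun w =>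
          congrArg (J' ^ m) (hJ w)
        simp only [map_sub, Function.iterate_succ_apply', pow_succ, hmul]
        abel
    simp_rw [← htel]
    exact (hsum z hz).hasSum.tendsto_sum_nat.const_add _

theorem exists_linearization {φ : E → E} (hφ : AnalyticOnNhd ℂ φ (ball 0 1))
    (hmaps : MapsTo φ (ball 0 1) (ball 0 1)) (h0 : φ 0 = 0)
    (hcontr : ∀ r : ℝ, 0 < r → r < 1 →
      ∃ q : ℝ, 0 ≤ q ∧ q < 1 ∧ ∀ z, ‖z‖ < r → ‖φ z‖ ≤ q * ‖z‖)
    {J J' : W →L[ℂ] W} (hJJ' : ∀ w, J (J' w) = w) (hJ'J : ∀ w, J' (J w) = w)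
    {D : E →L[ℂ] W} (hD : ∀ z, D (fderiv ℂ φ 0 z) = J (D z))
    (hJ : ∀ (K : ℕ), 2 ≤ K → ∀ c : Fin K → ℂ,
      (∀ i, End.HasEigenvalue (fderiv ℂ φ 0 : End ℂ E) (c i)) →
      ¬ End.HasEigenvalue (J : End ℂ W) (∏ i, c i)) :
    ∃ F : E → W, AnalyticOnNhd ℂ F (ball 0 1) ∧ (∀ z ∈ ball (0 : E) 1, F (φ z) = J (F z)) ∧
      fderiv ℂ F 0 = D := by
  have h0b : (0 : E) ∈ ball (0 : E) 1 := mem_ball_self one_pos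
  obtain ⟨q, hq0, hq1, hq⟩ := hcontr (1 / 2) (by norm_num) (by norm_num)
  obtain ⟨K, hK⟩ : ∃ K : ℕ, ‖J'‖ * q ^ (K + 2) < 1 := by
    have ht : Tendsto (fun K : ℕ => ‖J'‖ * q ^ (K + 2)) atTop (𝓝 (‖J'‖ * 0)) :=
      ((tendsto_add_atTop_iff_nat 2).mpr (tendsto_pow_atTop_nhds_zero_of_lt_one hq0 hq1)).const_mul _
    rw [mul_zero] at ht
    exact (ht.eventually_lt_const one_pos).exists
  obtain ⟨F₀, hF₀, hF₀D, hF₀G⟩ := exists_approximate_solution (hφ 0 h0b) h0 hD hJ K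
  obtain ⟨C, hC0, hC⟩ := hF₀G.exists_pos
  obtain ⟨δ', hδ', hCδ⟩ := Metric.eventually_nhds_iff.mp hC.bound
  set δ := min δ' (1 / 2) with hδdef
  have hδ : 0 < δ := lt_min hδ' (by norm_num)
  have hδ2 : δ ≤ 1 / 2 := min_le_right _ _
  have hsub : ball (0 : E) δ ⊆ ball 0 1 := ball_subset_ball (by linarith)
  obtain ⟨L, hLa, hLF, hL⟩ := exists_local_limit hJ'J hδ hC0.le hq0 hq1 (hφ.mono hsub)
    (fun z hz => hq z (hz.trans_le hδ2)) (fun z _ => hF₀ z trivial)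
    (fun z hz => by
      have := hCδ (y := z) (by rw [dist_zero_right]; exact hz.trans_le (min_le_left _ _))
      rwa [norm_pow, norm_norm] at this) hK
  obtain ⟨ε, hε, hεL⟩ := Metric.eventually_nhds_iff.mp hLa.eventually_analyticAt
  set T : ℕ → E → W := fun m z => (J' ^ m) (F₀ (φ^[m] z)) with hT
  have hTadd : ∀ N m z, T (m + N) z = (J' ^ N) (T m (φ^[N] z)) := fun N m z => by
    simp only [hT]
    rw [Function.iterate_add_apply, add_comm m N, pow_add]
    rfl
  -- Once the orbit has entered the small ball, the tail of the sequence is the local one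
  -- transported by `J' ^ N`.
  have hlim : ∀ N z, ‖φ^[N] z‖ < δ →
      Tendsto (fun m => T m z) atTop (𝓝 ((J' ^ N) (L (φ^[N] z)))) := fun N z hz => by
    rw [← tendsto_add_atTop_iff_nat N]
    simp_rw [hTadd]
    exact ((J' ^ N).continuous.tendsto _).comp (hL _ hz)
  have hsmall : ∀ z ∈ ball (0 : E) 1, ∀ ρ > 0, ∃ N, ‖φ^[N] z‖ < ρ := fun z hz ρ hρ => by
    rw [mem_ball_zero_iff] at hz
    obtain ⟨r, hr, hr1⟩ := exists_between hz
    obtain ⟨p, hp0, hp1, hp⟩ := hcontr r ((norm_nonneg z).trans_lt hr) hr1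
    have ht : Tendsto (fun N : ℕ => p ^ N * ‖z‖) atTop (𝓝 (0 * ‖z‖)) :=
      (tendsto_pow_atTop_nhds_zero_of_lt_one hp0 hp1).mul_const _
    rw [zero_mul] at ht
    obtain ⟨N, hN⟩ := (ht.eventually_lt_const hρ).exists
    exact ⟨N, (norm_iterate_le_of_norm_le_mul hp0 hp1 hp hr N).trans_lt hN⟩
  set F : E → W := fun z => limUnder atTop fun m => T m z with hF
  have hFN : ∀ N z, ‖φ^[N] z‖ < δ → F z = (J' ^ N) (L (φ^[N] z)) := fun N z hz =>
    (hlim N z hz).limUnder_eq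
  have hFT : ∀ z ∈ ball (0 : E) 1, Tendsto (fun m => T m z) atTop (𝓝 (F z)) := fun z hz => by
    obtain ⟨N, hN⟩ := hsmall z hz δ hδ
    exact hFN N z hN ▸ hlim N z hN
  refine ⟨F, fun z hz => ?_, fun z hz => ?_, ?_⟩
  -- `δ` secures convergence and `ε` analyticity of `L`; by continuity the same `N` serves all
  -- points near `z`.
  · obtain ⟨N, hN⟩ := hsmall z hz (min δ ε) (lt_min hδ hε)
    have hφN := hφ.iterate hmaps N z hz
    have hev : ∀ᶠ w in 𝓝 z, ‖φ^[N] w‖ < δ :=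
      hφN.continuousAt.norm.eventually_lt_const (hN.trans_le (min_le_left _ _))
    have hLN : AnalyticAt ℂ L (φ^[N] z) := hεL (by
      rw [dist_zero_right]; exact hN.trans_le (min_le_right _ _))
    have han : AnalyticAt ℂ (fun w => (J' ^ N) (L (φ^[N] w))) z :=
      ((J' ^ N).analyticAt _).comp (hLN.comp hφN)
    exact han.congr (hev.mono fun w hw => (hFN N w hw).symm)
  · have h1 := hFT _ (hmaps hz)
    have h2 : Tendsto (fun m => J (T (m + 1) z)) atTop (𝓝 (J (F z))) :=
      (J.continuous.tendsto _).comp ((tendsto_add_atTop_iff_nat 1).mpr (hFT z hz))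
    refine tendsto_nhds_unique h1 (h2.congr fun m => ?_)
    rw [hTadd, pow_one, hJJ']
    rfl
  · have hFL : F =ᶠ[𝓝 0] L := by
      filter_upwards [ball_mem_nhds (0 : E) hδ] with z hz
      simpa using hFN 0 z (mem_ball_zero_iff.mp hz)
    have hpow : (fun z : E => ‖z‖ ^ (K + 2)) =O[𝓝 0] fun z => ‖z‖ ^ 2 := by
      refine IsBigO.of_bound 1 ?_
      filter_upwards [ball_mem_nhds (0 : E) one_pos] with z hz
      rw [one_mul, norm_pow, norm_pow, norm_norm]
      exact pow_le_pow_of_le_one (norm_nonneg _) (mem_ball_zero_iff.mp hz).le (by omega)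
    have hLD : (fun z => L z - D z) =O[𝓝 0] fun z => ‖z‖ ^ 2 :=
      ((hLF.trans hpow).add hF₀D).congr_left fun z => sub_add_sub_cancel _ _ _
    rw [hFL.fderiv_eq]
    have hL0 : L 0 = 0 := by
      have := (hLD.congr_right fun z => by rw [sub_zero]).eq_zero_of_norm_pow
        (x₀ := (0 : E)) two_ne_zero
      simpa using this
    refine HasFDerivAt.fderiv (HasFDerivAt.of_isLittleO ?_)
    simp only [hL0, sub_zero]
    refine hLD.trans_isLittleO ?_
    simpa using (isLittleO_norm_pow_id (E' := E) one_lt_two)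

end Linearization

/-! ### Spectrum and restriction of Jordan matrices -/

section JordanMatrix

open Matrix

theorem det_sub_jordanBlock (x c : ℂ) (k : ℕ) :
    (algebraMap ℂ (Matrix (Fin k) (Fin k) ℂ) x - jordanBlock c k).det = (x - c) ^ k := by
  rw [Matrix.det_of_isUpperTriangular]
  · simp [jordanBlock, Matrix.algebraMap_matrix_apply]
  · intro i j hij
    have h1 : j < i := hij
    have h2 : i ≠ j := h1.ne'
    have h3 : (i : ℕ) + 1 ≠ j := by have : (j : ℕ) < i := h1; omega
    simp [jordanBlock, Matrix.algebraMap_matrix_apply, h2, h3]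

theorem spectrum_jordanMatrix_subset {β : Type} [Fintype β] [DecidableEq β] (c : β → ℂ)
    (k : β → ℕ) : spectrum ℂ (jordanMatrix c k) ⊆ Set.range c := by
  intro x hx
  by_contra hc
  refine hx ?_
  have h : algebraMap ℂ (Matrix (Σ b, Fin (k b)) (Σ b, Fin (k b)) ℂ) x - jordanMatrix c k =
      Matrix.blockDiagonal' fun b =>
        algebraMap ℂ (Matrix (Fin (k b)) (Fin (k b)) ℂ) x - jordanBlock (c b) (k b) := by
    rw [jordanMatrix, Algebra.algebraMap_eq_smul_one, ← Matrix.blockDiagonal'_one,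
      ← Matrix.blockDiagonal'_smul, ← Matrix.blockDiagonal'_sub]
    congr 1
    funext b
    simp [Algebra.algebraMap_eq_smul_one]
  rw [spectrum.mem_resolventSet_iff, h]
  have hu : IsUnit fun b =>
      algebraMap ℂ (Matrix (Fin (k b)) (Fin (k b)) ℂ) x - jordanBlock (c b) (k b) := by
    refine Pi.isUnit_iff.mpr fun b => ?_
    rw [Matrix.isUnit_iff_isUnit_det, det_sub_jordanBlock, isUnit_iff_ne_zero]
    exact pow_ne_zero _ (sub_ne_zero.mpr fun h => hc ⟨b, h.symm⟩)
  exact hu.map (Matrix.blockDiagonal'RingHom (fun b => Fin (k b)) ℂ)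

/-- The inclusion of the indices of `jordanPart c k μ` into those of `jordanMatrix c k`. -/
def jordanPartIndex {m : ℕ} (c : Fin m → ℂ) (k : Fin m → ℕ) (μ : ℂ) :
    (Σ j : {j : Fin m // c j = μ}, Fin (k j)) → Σ j, Fin (k j) :=
  Sigma.map Subtype.val fun _ => id

theorem jordanPartIndex_injective {m : ℕ} (c : Fin m → ℂ) (k : Fin m → ℕ) (μ : ℂ) :
    Function.Injective (jordanPartIndex c k μ) :=
  Subtype.val_injective.sigma_map fun _ => Function.injective_id

theorem jordanPartIndex_mk {m : ℕ} (c : Fin m → ℂ) (k : Fin m → ℕ) (μ : ℂ)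
    (j : {j : Fin m // c j = μ}) (a : Fin (k j)) :
    jordanPartIndex c k μ ⟨j, a⟩ = ⟨j, a⟩ := rfl

/-- Distinct blocks do not interact, so the intertwining relation for the full Jordan matrix
restricts to the rows over `μ`. -/
theorem jordanPart_mul_submatrix {m : ℕ} {κ : Type} (c : Fin m → ℂ) (k : Fin m → ℕ) (μ : ℂ)
    (D : Matrix (Σ j, Fin (k j)) κ ℂ) :
    jordanPart c k μ * D.submatrix (jordanPartIndex c k μ) id =
      (jordanMatrix c k * D).submatrix (jordanPartIndex c k μ) id := by
  ext ⟨⟨i, hi⟩, a⟩ t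
  simp only [Matrix.mul_apply, Matrix.submatrix_apply, id, jordanPartIndex_mk]
  refine Fintype.sum_of_injective _ (jordanPartIndex_injective c k μ) _ _ ?_ ?_
  · rintro ⟨j, b⟩ hj
    have hij : i ≠ j := by
      rintro rfl
      exact hj ⟨⟨⟨i, hi⟩, b⟩, rfl⟩
    rw [jordanMatrix, Matrix.blockDiagonal'_apply_ne _ _ _ hij, zero_mul]
  · rintro ⟨⟨j, hj⟩, b⟩
    rw [jordanPartIndex_mk]
    congr 1
    by_cases hij : i = j
    · subst hij
      simp [jordanPart, jordanMatrix, Matrix.blockDiagonal'_apply_eq]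
    · rw [jordanPart, jordanMatrix, jordanMatrix, Matrix.blockDiagonal'_apply_ne _ _ _ hij,
        Matrix.blockDiagonal'_apply_ne]
      simpa using hij

end JordanMatrix

/-! ### Passage to matrices and the rank condition -/

section FullRankSolution

open Matrix Metric Set Topology Module

variable {n : ℕ} {φ : EuclideanSpace ℂ (Fin n) → EuclideanSpace ℂ (Fin n)}

theorem toEuclideanLin_jacobian {ι : Type} [Fintype ι]
    (F : EuclideanSpace ℂ (Fin n) → EuclideanSpace ℂ ι) (z : EuclideanSpace ℂ (Fin n)) :
    toEuclideanLin (jacobian F z) = (fderiv ℂ F z : EuclideanSpace ℂ (Fin n) →ₗ[ℂ] _) := by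
  refine (EuclideanSpace.basisFun (Fin n) ℂ).toBasis.ext fun j => ?_
  ext i
  simp [jacobian, toLpLin_apply]

theorem isResonantEigenvalue_prod {A : Matrix (Fin n) (Fin n) ℂ} {K : ℕ} (hK : 2 ≤ K)
    {c : Fin K → ℂ} (hc : ∀ i, c i ∈ spectrum ℂ A) (hprod : ∏ i, c i ∈ spectrum ℂ A) :
    IsResonantEigenvalue A (∏ i, c i) := by
  classical
  refine ⟨hprod, ∑ i, Finsupp.single ⟨c i, hc i⟩ 1, ?_, ?_⟩
  · rw [← Finsupp.sum_finsetSum_index (fun _ => rfl) (fun _ _ _ => rfl)]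
    simp
    omega
  · rw [← Finsupp.prod_finsetSum_index (fun _ => pow_zero _) (fun _ _ _ => pow_add _ _ _)]
    simp

/-- The determinant of `jacobian F z * B` is continuous at `z₀` and equals one there; where it is
nonzero, the Jacobian has full row rank. -/
theorem eventually_rank_jacobian_eq_card {ι : Type} [Fintype ι] [DecidableEq ι]
    {F : EuclideanSpace ℂ (Fin n) → EuclideanSpace ℂ ι} {z₀ : EuclideanSpace ℂ (Fin n)}
    (hF : AnalyticAt ℂ F z₀) {B : Matrix (Fin n) ι ℂ} (hB : jacobian F z₀ * B = 1) :
    ∀ᶠ z in 𝓝 z₀, (jacobian F z).rank = Fintype.card ι := by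
  have hcont : ContinuousAt (fun z => jacobian F z) z₀ := by
    refine continuousAt_pi.mpr fun i => continuousAt_pi.mpr fun j => ?_
    have h1 : ContinuousAt (fun z => fderiv ℂ F z (EuclideanSpace.single j 1)) z₀ :=
      hF.fderiv.continuousAt.clm_apply continuousAt_const
    exact (EuclideanSpace.proj (𝕜 := ℂ) i).continuous.continuousAt.comp h1
  have hdet : ContinuousAt (fun z => (jacobian F z * B).det) z₀ :=
    ContinuousAt.comp (f := fun z => jacobian F z) (g := fun M : Matrix ι (Fin n) ℂ => (M * B).det)
      (Continuous.matrix_det (continuous_id.matrix_mul continuous_const)).continuousAt hcont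
  have hne : (jacobian F z₀ * B).det ≠ 0 := by simp [hB]
  filter_upwards [hdet.eventually_ne hne] with z hz
  refine le_antisymm (rank_le_card_height _) ?_
  have hu : IsUnit (jacobian F z * B) :=
    (Matrix.isUnit_iff_isUnit_det _).mpr (isUnit_iff_ne_zero.mpr hz)
  rw [← rank_of_isUnit _ hu]
  exact rank_mul_le_left _ _

theorem exists_isFullRankSolution (hφ : AnalyticOnNhd ℂ φ (ball 0 1))
    (hmaps : MapsTo φ (ball 0 1) (ball 0 1)) (hzero : φ 0 = 0)
    (hinv : IsUnit (jacobian φ 0)) (hslice : ¬ IsUnitaryOnSomeSlice φ)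
    {ι : Type} [Fintype ι] [DecidableEq ι] {M : Matrix ι ι ℂ} {D : Matrix ι (Fin n) ℂ}
    {B : Matrix (Fin n) ι ℂ} (hDB : D * B = 1) (hDM : D * jacobian φ 0 = M * D)
    (hM : ∀ μ ∈ spectrum ℂ M,
      μ ∈ spectrum ℂ (jacobian φ 0) ∧ ¬ IsResonantEigenvalue (jacobian φ 0) μ) :
    ∃ F, IsFullRankSolution φ M F := by
  obtain ⟨A', hA'⟩ := hinv.exists_right_inv
  -- `M` inherits invertibility from `φ'(0)` through the intertwining relation and the right inverse
  -- of `D`.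
  have hMinv : M * (D * A' * B) = 1 := by
    rw [← Matrix.mul_assoc, ← Matrix.mul_assoc, ← hDM, Matrix.mul_assoc D, hA', Matrix.mul_one,
      hDB]
  have hMinv' : D * A' * B * M = 1 := mul_eq_one_comm.mp hMinv
  have hlin := toEuclideanLin_jacobian φ 0
  have happ : ∀ {κ κ' : Type} [Fintype κ] [DecidableEq κ] [Fintype κ'] [DecidableEq κ']
      (N : Matrix κ κ' ℂ) (v : EuclideanSpace ℂ κ'),
      (toEuclideanLin N).toContinuousLinearMap v = WithLp.toLp 2 (N *ᵥ v.ofLp) :=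
    fun N v => rfl
  have hfd : ∀ v, fderiv ℂ φ 0 v = WithLp.toLp 2 (jacobian φ 0 *ᵥ v.ofLp) := fun v =>
    (LinearMap.congr_fun hlin v).symm
  obtain ⟨F, hF, hFeq, hFD⟩ := exists_linearization hφ hmaps hzero
    (fun r hr0 hr1 => exists_norm_le_mul_of_not_isUnitaryOnSomeSlice hφ hmaps hzero hslice hr0 hr1)
    (J := (toEuclideanLin M).toContinuousLinearMap)
    (J' := (toEuclideanLin (D * A' * B)).toContinuousLinearMap)
    (D := (toEuclideanLin D).toContinuousLinearMap)
    (fun w => by simp only [happ]; rw [mulVec_mulVec, hMinv, one_mulVec])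
    (fun w => by simp only [happ]; rw [mulVec_mulVec, hMinv', one_mulVec])
    (fun z => by
      rw [hfd]
      simp only [happ]
      rw [mulVec_mulVec, mulVec_mulVec, hDM])
    (fun K hK c hc hprod => by
      have hspec : ∀ i, c i ∈ spectrum ℂ (jacobian φ 0) := fun i => by
        have := hc i
        rwa [← hlin, Module.End.hasEigenvalue_iff_mem_spectrum,
          spectrum_toLpLin] at this
      have hMs : ∏ i, c i ∈ spectrum ℂ M := by
        rw [LinearMap.coe_toContinuousLinearMap, Module.End.hasEigenvalue_iff_mem_spectrum,
          spectrum_toLpLin] at hprod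
        exact hprod
      exact (hM _ hMs).2 (isResonantEigenvalue_prod hK hspec (hM _ hMs).1))
  have hjac : jacobian F 0 = D := by
    apply toEuclideanLin.injective
    rw [toEuclideanLin_jacobian, hFD]
    rfl
  exact ⟨F, hF, hFeq, eventually_rank_jacobian_eq_card (hF 0 (mem_ball_self one_pos))
    (B := B) (by rw [hjac, hDB])⟩

end FullRankSolution

theorem mainTheorem6 (n : ℕ) (φ : EuclideanSpace ℂ (Fin n) → EuclideanSpace ℂ (Fin n))
    (hφ : AnalyticOnNhd ℂ φ (Metric.ball 0 1))
    (hmaps : Set.MapsTo φ (Metric.ball 0 1) (Metric.ball 0 1))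
    (hzero : φ 0 = 0)
    (hinv : IsUnit (jacobian φ 0))
    (hslice : ¬ IsUnitaryOnSomeSlice φ) :
    (∀ (m : ℕ) (c : Fin m → ℂ) (k : Fin m → ℕ), IsJordanForm (jacobian φ 0) c k →
      ∀ μ ∈ spectrum ℂ (jacobian φ 0), ¬ IsResonantEigenvalue (jacobian φ 0) μ →
        ∃ F : EuclideanSpace ℂ (Fin n) →
            EuclideanSpace ℂ (Σ j : {j : Fin m // c j = μ}, Fin (k j)),
          IsFullRankSolution φ (jordanPart c k μ) F) ∧
    ((∀ μ : ℂ, ¬ IsResonantEigenvalue (jacobian φ 0) μ) →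
      ∃ F : EuclideanSpace ℂ (Fin n) → EuclideanSpace ℂ (Fin n),
        IsFullRankSolution φ (jacobian φ 0) F) := by
  refine ⟨?_, fun hres => ?_⟩
  · rintro m c k ⟨-, D, E, hDE, hED, hJ⟩ μ hμ hres
    have hDA : D * jacobian φ 0 = jordanMatrix c k * D := by
      rw [← hJ, Matrix.mul_assoc, hED, Matrix.mul_one]
    refine exists_isFullRankSolution hφ hmaps hzero hinv hslice
      (D := D.submatrix (jordanPartIndex c k μ) id) (B := E.submatrix id (jordanPartIndex c k μ)) ?_ ?_ ?_
    · rw [← Matrix.submatrix_mul _ _ _ _ _ Function.bijective_id, hDE,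
        Matrix.submatrix_one _ (jordanPartIndex_injective c k μ)]
    · rw [jordanPart_mul_submatrix, ← hDA, Matrix.submatrix_mul _ _ _ _ _ Function.bijective_id,
        Matrix.submatrix_id_id]
    · intro x hx
      obtain ⟨⟨j, hj⟩, rfl⟩ := spectrum_jordanMatrix_subset _ _ hx
      simp only [hj]
      exact ⟨hμ, hres⟩
  · exact exists_isFullRankSolution hφ hmaps hzero hinv hslice (D := 1) (B := 1)
      (Matrix.one_mul _) (by rw [Matrix.one_mul, Matrix.mul_one]) fun μ hμ => ⟨hμ, hres μ⟩
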